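/- Let $q$ be an indeterminate. For a nonnegative integer $r$ put $[r]=(1-q^r)/(1-q)$, let $(x;q^3)_k=\prod_{i=0}^{k-1}(1-xq^{3i})$, and let $\Phi_n(q)$ be the $n$-th cyclotomic polynomial in $q$. For rational functions $A,B\in\mathbb{Q}(q)$ and a polynomial $P\in\mathbb{Q}[q]$, write $A\equiv B\pmod{P}$ if $P$ divides, in $\mathbb{Q}[q]$, the numerator of $A-B$ written in lowest terms. Let $n$ be a positive integer with $n\equiv 1\pmod 3$, and let $M=(n-1)/3$ or $M=n-1$. Then, modulo $[n]\Phi_n(q)^4$, $$\sum_{k=0}^{M}[6k+1]\frac{(q;q^3)_k^6}{(q^3;q^3)_k^6}\,q^{3k}\equiv[n]\,\frac{(q^2;q^3)_{(n-1)/3}^3}{(q^3;q^3)_{(n-1)/3}^3}\left\{1+[n]^2(2-q^{n})\sum_{j=1}^{(n-1)/3}\left(\frac{q^{3j-1}}{[3j-1]^2}-\frac{q^{3j}}{[3j]^2}\right)\right\}.$$ -/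

import Mathlib

namespace QSuper

open Polynomial

/-- The `q`-shifted factorial `(x; q)_k = (1 - x)(1 - x q) ⋯ (1 - x q^(k-1))`. -/
def qPoch {K : Type*} [CommRing K] (x q : K) (k : ℕ) : K :=
  ∏ i ∈ Finset.range k, (1 - x * q ^ i)

/-- The indeterminate `q` of the field `ℚ(q)` of rational functions. -/
noncomputable def q : RatFunc ℚ := RatFunc.X

/-- The `q`-integer `[r] = (1 - q^r) / (1 - q)` in `ℚ(q)`. -/
noncomputable def qInt (r : ℕ) : RatFunc ℚ := (1 - q ^ r) / (1 - q)

/-- The `q`-integer `[r] = 1 + q + ⋯ + q^(r-1)` as an element of `ℚ[q]`. -/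
noncomputable def qIntPoly (r : ℕ) : ℚ[X] := ∑ i ∈ Finset.range r, X ^ i

/-- The polynomial and the rational function `[r]` agree. -/
theorem algebraMap_qIntPoly (r : ℕ) :
    algebraMap ℚ[X] (RatFunc ℚ) (qIntPoly r) = qInt r := by
  have h1 : (1 : ℚ[X]) - X ≠ 0 := by
    intro h
    have h2 := congrArg (Polynomial.eval 0) h
    simp at h2
  have h3 : (1 : RatFunc ℚ) - q ≠ 0 := by
    have h4 := (map_ne_zero_iff (algebraMap ℚ[X] (RatFunc ℚ))
      (RatFunc.algebraMap_injective ℚ)).2 h1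
    simpa [q, RatFunc.algebraMap_X] using h4
  rw [qInt, eq_div_iff h3]
  have h5 : qIntPoly r * (1 - X) = 1 - X ^ r := geom_sum_mul_neg X r
  have h6 := congrArg (algebraMap ℚ[X] (RatFunc ℚ)) h5
  simpa [q, RatFunc.algebraMap_X] using h6

/-- Congruence of rational functions modulo a polynomial `P`: the numerator of `A - B`, written in
lowest terms, is divisible by `P`. -/
def RatCongr (P : ℚ[X]) (A B : RatFunc ℚ) : Prop := P ∣ (A - B).num

end QSuper

/-! Write n = 3m+1. Replacing a square (1-z)^2 by (1-z)^2 + Uz = (1-az)(1-z/a), where U = 2-a-1/a,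
in the numerators and denominators of the series deforms it. Let S(U,V) be the numerator series
(without the factor 1/(1-q)), truncated at m, with two of its three squares deformed. At V = X :=
`termParam q m`, which corresponds to a = q^n, it terminates, and a case of Jackson's summation
evaluates S(U,X) (`sum_deform`).

The series wanted is S(0,0). With D_k the factor by which X deforms the k-th term, 1 = 2D_k - D_k^2
+ (1-D_k)^2 gives S(0,0) = 2S(0,X) - S(X,X) + X^2 Ω. Here X^2 is (1-q^n)^4 up to a power of q. At a
primitive n-th root of unity, Ω becomes a sum weighted by squared logarithmic derivatives, which the
reflection k ↦ m-k carries to its negative (`sum_reflect_eq_zero`). Hence the error carries Φ_n^5,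
and expanding the product side to first order in X yields the stated right-hand side
(`exists_short_sum_sub_closedForm`). For M = n-1 the additional terms contain (1-q^n)^6.

For the other divisors d > 1 of n a single factor Φ_d is needed. Both sides vanish at primitive d-th
roots of unity: the series splits into blocks of length d, each killed by the same reflection
(`hasVal_sum`), and the right side contains [n] (`hasVal_closedForm`). Coprimality of cyclotomic
polynomials assembles the modulus (`modulus_dvd_num`). -/

namespace QSuper

open Polynomial

/-! ### Jackson's terminating summation, by telescoping in m -/

section Jackson

variable {K : Type*} [Field K]

/-- The very-well-poised ratio with a deformation parameter `U`. -/
def wpRatio (q U : K) (i : ℕ) : K :=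
  ((1 - q ^ (3 * i + 1)) ^ 2 * ((1 - q ^ (3 * i + 1)) ^ 2 + U * q ^ (3 * i + 1))) /
    ((1 - q ^ (3 * i + 3)) ^ 2 * ((1 - q ^ (3 * i + 3)) ^ 2 + U * q ^ (3 * i + 3)))

/-- The ratio attached to the terminating parameter `q ^ (-3 m)` and its companion. -/
def termRatio (q : K) (m i : ℕ) : K :=
  ((q ^ (3 * m) - q ^ (3 * i)) * (1 - q ^ (3 * m + 3 * i + 2))) /
    ((1 - q ^ (3 * m + 3 * i + 4)) * (q ^ (3 * m) - q ^ (3 * i + 2)))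

/-- The summand of the terminating very-well-poised series. -/
def jacksonTerm (q U : K) (m k : ℕ) : K :=
  (1 - q ^ (6 * k + 1)) * q ^ (3 * k) *
    ((∏ i ∈ Finset.range k, wpRatio q U i) * ∏ i ∈ Finset.range k, termRatio q m i)

/-- The common part of two consecutive summands in the telescoping argument. -/
def mixedRatio (q : K) (m i : ℕ) : K :=
  ((q ^ (3 * m + 3) - q ^ (3 * i)) * (1 - q ^ (3 * m + 3 * i + 2))) /
    ((1 - q ^ (3 * m + 3 * i + 4)) * (q ^ (3 * m + 3) - q ^ (3 * i + 2)))

theorem pow_sub_pow_ne_zero {q : K} (hq0 : q ≠ 0) (hq : ∀ k, 0 < k → q ^ k ≠ 1) {a b : ℕ}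
    (hab : a ≠ b) : q ^ a - q ^ b ≠ 0 := by
  intro h
  wlog hlt : a < b generalizing a b
  · exact this hab.symm (by linear_combination -h) (by omega)
  · obtain ⟨c, rfl⟩ := Nat.exists_eq_add_of_lt hlt
    have h1 : q ^ a * (q ^ (c + 1) - 1) = 0 := by
      rw [show a + c + 1 = a + (c + 1) by ring, pow_add] at h
      linear_combination -h
    rcases mul_eq_zero.1 h1 with h2 | h2
    · exact pow_ne_zero _ hq0 h2
    · exact hq (c + 1) (by omega) (by linear_combination h2)

theorem one_sub_pow_ne_zero {q : K} (hq : ∀ k, 0 < k → q ^ k ≠ 1) {a : ℕ} (ha : 0 < a) :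
    1 - q ^ a ≠ 0 := fun h => hq a ha (by linear_combination -h)

/-- `mixedRatio` takes two factors from level m and two from level m+1, so its quotient with either
`termRatio` telescopes and leaves only boundary factors. This puts the summands at m and m+1 over a
common product. -/
theorem prod_termRatio_succ {q : K} (hq0 : q ≠ 0) (hq : ∀ k, 0 < k → q ^ k ≠ 1) (m k : ℕ) :
    ∏ i ∈ Finset.range k, termRatio q (m + 1) i =
      (∏ i ∈ Finset.range k, mixedRatio q m i) *
        (((1 - q ^ (3 * m + 3 * k + 2)) * (1 - q ^ (3 * m + 4))) /
          ((1 - q ^ (3 * m + 2)) * (1 - q ^ (3 * m + 3 * k + 4)))) := by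
  have e (a : ℕ) : 1 - q ^ (a + 1) ≠ 0 := one_sub_pow_ne_zero hq (Nat.succ_pos a)
  induction k with
  | zero =>
    have h1 := e (3 * m + 1)
    have h2 := e (3 * m + 3)
    simp only [Finset.range_zero, Finset.prod_empty, Nat.mul_zero, Nat.add_zero, one_mul]
    rw [mul_comm, div_self (mul_ne_zero h2 h1)]
  | succ k ih =>
    rw [Finset.prod_range_succ, Finset.prod_range_succ, ih, mul_assoc, mul_assoc]
    congr 1
    have h1 := e (3 * m + 1)
    have h2 := e (3 * m + 3 * k + 3)
    have h3 := e (3 * m + 3 * k + 6)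
    have h4 : q ^ (3 * m + 3) - q ^ (3 * k + 2) ≠ 0 := pow_sub_pow_ne_zero hq0 hq (by omega)
    simp only [termRatio, mixedRatio]
    rw [show 3 * (m + 1) + 3 * k + 2 = 3 * m + 3 * k + 5 by ring,
      show 3 * (m + 1) + 3 * k + 4 = 3 * m + 3 * k + 6 + 1 by ring,
      show 3 * m + 3 * (k + 1) + 2 = 3 * m + 3 * k + 5 by ring,
      show 3 * m + 3 * (k + 1) + 4 = 3 * m + 3 * k + 6 + 1 by ring,
      show 3 * (m + 1) = 3 * m + 3 by ring]
    rw [div_mul_div_comm, div_mul_div_comm, div_eq_div_iff (by simp only [mul_ne_zero_iff]; tauto) (by simp only [mul_ne_zero_iff]; tauto)]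
    ring

theorem prod_termRatio {q : K} (hq0 : q ≠ 0) (hq : ∀ k, 0 < k → q ^ k ≠ 1) (m k : ℕ) :
    ∏ i ∈ Finset.range k, termRatio q m i =
      (∏ i ∈ Finset.range k, mixedRatio q m i) *
        (((q ^ (3 * m + 3) - q ^ (3 * k)) * (q ^ (3 * m + 3) - q ^ 2)) /
          ((q ^ (3 * m + 3) - 1) * (q ^ (3 * m + 3) - q ^ (3 * k + 2)))) := by
  have h1 : q ^ (3 * m + 3) - 1 ≠ 0 := by
    simpa using pow_sub_pow_ne_zero hq0 hq (a := 3 * m + 3) (b := 0) (by omega)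
  induction k with
  | zero =>
    have h2 : q ^ (3 * m + 3) - q ^ 2 ≠ 0 := pow_sub_pow_ne_zero hq0 hq (by omega)
    simp only [Finset.range_zero, Finset.prod_empty, Nat.mul_zero, Nat.zero_add, one_mul, pow_zero]
    rw [div_self (mul_ne_zero h1 h2)]
  | succ k ih =>
    rw [Finset.prod_range_succ, Finset.prod_range_succ, ih, mul_assoc, mul_assoc]
    congr 1
    have h2 : 1 - q ^ (3 * m + 3 * k + 4) ≠ 0 := one_sub_pow_ne_zero hq (by omega)
    have h3 : q ^ (3 * m) - q ^ (3 * k + 2) ≠ 0 := pow_sub_pow_ne_zero hq0 hq (by omega)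
    have h4 : q ^ (3 * m + 3) - q ^ (3 * k + 2) ≠ 0 := pow_sub_pow_ne_zero hq0 hq (by omega)
    have h5 : q ^ (3 * m + 3) - q ^ (3 * (k + 1) + 2) ≠ 0 := pow_sub_pow_ne_zero hq0 hq (by omega)
    simp only [termRatio, mixedRatio]
    rw [div_mul_div_comm, div_mul_div_comm,
      div_eq_div_iff (by simp only [mul_ne_zero_iff]; tauto) (by simp only [mul_ne_zero_iff]; tauto)]
    ring

/-- The rational-function identity behind the telescoping, with `y = q ^ (3 k)` and
`M = q ^ (3 m)`. -/
theorem telescoping_certificate (q U y M : K) (h1 : 1 - q ^ 2 * M ≠ 0)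
    (h2 : 1 - q ^ 4 * M * y ≠ 0) (h3 : q ^ 3 * M - 1 ≠ 0) (h4 : q ^ 3 * M - q ^ 2 * y ≠ 0)
    (h5 : 1 - q * M ≠ 0) (h6 : (1 - q ^ 3 * M) ^ 2 + U * (q ^ 3 * M) ≠ 0)
    (h7 : 1 - q ^ 3 * y ≠ 0) (h8 : (1 - q ^ 3 * y) ^ 2 + U * (q ^ 3 * y) ≠ 0) :
    (1 - q * y ^ 2) * y *
        (((1 - q ^ 2 * M * y) * (1 - q ^ 4 * M)) / ((1 - q ^ 2 * M) * (1 - q ^ 4 * M * y))) -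
      (1 - q ^ 4 * M) / (1 - q * M) *
        (((1 - q ^ 2 * M) * ((1 - q ^ 2 * M) ^ 2 + U * (q ^ 2 * M))) /
          ((1 - q ^ 3 * M) * ((1 - q ^ 3 * M) ^ 2 + U * (q ^ 3 * M)))) *
        ((1 - q * y ^ 2) * y *
        (((q ^ 3 * M - y) * (q ^ 3 * M - q ^ 2)) / ((q ^ 3 * M - 1) * (q ^ 3 * M - q ^ 2 * y)))) =
      q ^ 3 * M * (1 - q ^ 5 * M ^ 2) * (1 - q ^ 4 * M) /
        ((q ^ 3 * M - 1) * (1 - q ^ 2 * M) * (1 - q ^ 3 * M) *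
          ((1 - q ^ 3 * M) ^ 2 + U * (q ^ 3 * M))) *
      (((1 - q * y) ^ 2 * ((1 - q * y) ^ 2 + U * (q * y))) /
          ((1 - q ^ 3 * y) ^ 2 * ((1 - q ^ 3 * y) ^ 2 + U * (q ^ 3 * y))) *
        (((q ^ 3 * M - y) * (1 - q ^ 2 * M * y)) /
          ((1 - q ^ 4 * M * y) * (q ^ 3 * M - q ^ 2 * y))) *
        ((1 - q ^ 3 * y) ^ 2 * ((1 - q ^ 3 * y) ^ 2 + U * (q ^ 3 * y))) -
        (1 - y) ^ 2 * ((1 - y) ^ 2 + U * y)) := by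
  have h9 : 1 - q ^ 3 * M ≠ 0 := fun h => h3 (by linear_combination -h)
  have e1 : ((1 - q * y) ^ 2 * ((1 - q * y) ^ 2 + U * (q * y))) /
          ((1 - q ^ 3 * y) ^ 2 * ((1 - q ^ 3 * y) ^ 2 + U * (q ^ 3 * y))) *
        (((q ^ 3 * M - y) * (1 - q ^ 2 * M * y)) /
          ((1 - q ^ 4 * M * y) * (q ^ 3 * M - q ^ 2 * y))) *
        ((1 - q ^ 3 * y) ^ 2 * ((1 - q ^ 3 * y) ^ 2 + U * (q ^ 3 * y))) =
        ((1 - q * y) ^ 2 * ((1 - q * y) ^ 2 + U * (q * y))) *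
        ((q ^ 3 * M - y) * (1 - q ^ 2 * M * y)) /
          ((1 - q ^ 4 * M * y) * (q ^ 3 * M - q ^ 2 * y)) := by
    rw [mul_right_comm, div_mul_cancel₀ _ (mul_ne_zero (pow_ne_zero 2 h7) h8), mul_div_assoc']
  -- This exposes the factor 1 - qM that cancels against the prefactor, which lowers the degree of
  -- the final identity.
  have e2 : q ^ 3 * M - q ^ 2 = -(q ^ 2 * (1 - q * M)) := by ring
  have e3 : (1 - q ^ 4 * M) / (1 - q * M) *
        (((1 - q ^ 2 * M) * ((1 - q ^ 2 * M) ^ 2 + U * (q ^ 2 * M))) /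
          ((1 - q ^ 3 * M) * ((1 - q ^ 3 * M) ^ 2 + U * (q ^ 3 * M)))) *
        ((1 - q * y ^ 2) * y *
        (((q ^ 3 * M - y) * (q ^ 3 * M - q ^ 2)) /
          ((q ^ 3 * M - 1) * (q ^ 3 * M - q ^ 2 * y)))) =
      -((1 - q ^ 4 * M) *
        ((1 - q ^ 2 * M) * ((1 - q ^ 2 * M) ^ 2 + U * (q ^ 2 * M))) *
        ((1 - q * y ^ 2) * y * ((q ^ 3 * M - y) * q ^ 2))) /
        (((1 - q ^ 3 * M) * ((1 - q ^ 3 * M) ^ 2 + U * (q ^ 3 * M))) *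
          ((q ^ 3 * M - 1) * (q ^ 3 * M - q ^ 2 * y))) := by
    rw [e2, div_mul_div_comm, mul_div_assoc', div_mul_div_comm, div_eq_div_iff]
    · ring
    · simp only [mul_ne_zero_iff]; tauto
    · simp only [mul_ne_zero_iff]; tauto
  rw [e1, e3, mul_div_assoc', div_sub_div _ _ (mul_ne_zero h1 h2)
    (mul_ne_zero (mul_ne_zero h9 h6) (mul_ne_zero h3 h4)), div_sub' (mul_ne_zero h2 h4),
    div_mul_div_comm, div_eq_div_iff]
  · ring
  · simp only [mul_ne_zero_iff]; tauto
  · simp only [mul_ne_zero_iff]; tauto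

/-- The denominators of the series deformed by `U` do not vanish. -/
def Admissible (q U : K) : Prop :=
  ∀ i : ℕ, (1 - q ^ (3 * i + 3)) ^ 2 + U * q ^ (3 * i + 3) ≠ 0

/-- The factors of the product side of the summation. -/
def sumRatio (q U : K) (i : ℕ) : K :=
  ((1 - q ^ (3 * i + 2)) * ((1 - q ^ (3 * i + 2)) ^ 2 + U * q ^ (3 * i + 2))) /
    ((1 - q ^ (3 * i + 3)) * ((1 - q ^ (3 * i + 3)) ^ 2 + U * q ^ (3 * i + 3)))

/-- Wilf–Zeilberger style recurrence in m: the difference of summands is a forward difference in k,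
and its primitive vanishes at k = 0 through the factor (1 - q^(3k))^2. -/
theorem sum_jacksonTerm_sub {q U : K} (hq0 : q ≠ 0) (hq : ∀ k, 0 < k → q ^ k ≠ 1)
    (hU : Admissible q U) (m k : ℕ) :
    ∑ j ∈ Finset.range k, (jacksonTerm q U (m + 1) j -
        (1 - q ^ (3 * m + 4)) / (1 - q ^ (3 * m + 1)) * sumRatio q U m * jacksonTerm q U m j) =
      q ^ 3 * q ^ (3 * m) * (1 - q ^ 5 * (q ^ (3 * m)) ^ 2) * (1 - q ^ 4 * q ^ (3 * m)) /
        ((q ^ 3 * q ^ (3 * m) - 1) * (1 - q ^ 2 * q ^ (3 * m)) * (1 - q ^ 3 * q ^ (3 * m)) *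
          ((1 - q ^ 3 * q ^ (3 * m)) ^ 2 + U * (q ^ 3 * q ^ (3 * m)))) *
      ((∏ i ∈ Finset.range k, wpRatio q U i) * (∏ i ∈ Finset.range k, mixedRatio q m i) *
        ((1 - q ^ (3 * k)) ^ 2 * ((1 - q ^ (3 * k)) ^ 2 + U * q ^ (3 * k)))) := by
  induction k with
  | zero => simp
  | succ k ih =>
    rw [Finset.sum_range_succ, ih, jacksonTerm, jacksonTerm, prod_termRatio_succ hq0 hq,
      prod_termRatio hq0 hq, Finset.prod_range_succ, Finset.prod_range_succ]
    have h := telescoping_certificate q U (q ^ (3 * k)) (q ^ (3 * m))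
      (by rw [← pow_add]; exact one_sub_pow_ne_zero hq (by omega))
      (by rw [← pow_add, ← pow_add]; exact one_sub_pow_ne_zero hq (by omega))
      (by rw [← pow_add]; simpa using pow_sub_pow_ne_zero hq0 hq (a := 3 + 3 * m) (b := 0) (by omega))
      (by rw [← pow_add, ← pow_add]; exact pow_sub_pow_ne_zero hq0 hq (by omega))
      (by rw [← pow_succ']; exact one_sub_pow_ne_zero hq (by omega))
      (by rw [← pow_add, add_comm 3]; exact hU m)
      (by rw [← pow_add]; exact one_sub_pow_ne_zero hq (by omega))
      (by rw [← pow_add, add_comm 3]; exact hU k)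
    simp only [wpRatio, mixedRatio, sumRatio]
    rw [show q ^ (3 * (k + 1)) = q ^ 3 * q ^ (3 * k) by ring,
      show q ^ (3 * k + 1) = q * q ^ (3 * k) by ring,
      show q ^ (3 * k + 2) = q ^ 2 * q ^ (3 * k) by ring,
      show q ^ (3 * k + 3) = q ^ 3 * q ^ (3 * k) by ring,
      show q ^ (6 * k + 1) = q * (q ^ (3 * k)) ^ 2 by ring,
      show q ^ (3 * m + 1) = q * q ^ (3 * m) by ring,
      show q ^ (3 * m + 2) = q ^ 2 * q ^ (3 * m) by ring,
      show q ^ (3 * m + 3) = q ^ 3 * q ^ (3 * m) by ring,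
      show q ^ (3 * m + 4) = q ^ 4 * q ^ (3 * m) by ring,
      show q ^ (3 * m + 3 * k + 2) = q ^ 2 * q ^ (3 * m) * q ^ (3 * k) by ring,
      show q ^ (3 * m + 3 * k + 4) = q ^ 4 * q ^ (3 * m) * q ^ (3 * k) by ring]
    have key (c₁ c₂ w x g c r₁ ρ r₂ φ μ g₁ : K)
        (h : c * r₁ - ρ * (c * r₂) = c₁ / c₂ * (φ * μ * g₁ - g)) :
        c₁ / c₂ * (w * x * g) + (c * (w * (x * r₁)) - ρ * (c * (w * (x * r₂)))) =
          c₁ / c₂ * (w * φ * (x * μ) * g₁) := by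
      linear_combination w * x * h
    exact key _ _ _ _ _ _ _ _ _ _ _ _ h

/-- A terminating case of Jackson's very-well-poised summation, in base `q ^ 3`. -/
theorem sum_jacksonTerm {q U : K} (hq0 : q ≠ 0) (hq : ∀ k, 0 < k → q ^ k ≠ 1)
    (hU : Admissible q U) (m : ℕ) :
    ∑ k ∈ Finset.range (m + 1), jacksonTerm q U m k =
      (1 - q ^ (3 * m + 1)) * ∏ i ∈ Finset.range m, sumRatio q U i := by
  induction m with
  | zero => simp [jacksonTerm]
  | succ m ih =>
    have h := sum_jacksonTerm_sub hq0 hq hU m (m + 1 + 1)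
    -- The upper boundary term vanishes because the factor i = m+1 has numerator q^(3m+3) - q^(3i) =
    -- 0.
    have h0 : ∏ i ∈ Finset.range (m + 1 + 1), mixedRatio q m i = 0 :=
      Finset.prod_eq_zero (Finset.self_mem_range_succ (m + 1)) (by simp [mixedRatio, mul_add])
    have h1 : jacksonTerm q U m (m + 1) = 0 := by
      have : ∏ i ∈ Finset.range (m + 1), termRatio q m i = 0 :=
        Finset.prod_eq_zero (Finset.self_mem_range_succ m) (by simp [termRatio])
      rw [jacksonTerm, this, mul_zero, mul_zero]
    rw [h0, mul_zero, zero_mul, mul_zero, Finset.sum_sub_distrib, ← Finset.mul_sum, sub_eq_zero,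
      Finset.sum_range_succ (fun j => jacksonTerm q U m j), h1, add_zero, ih] at h
    rw [h, Finset.prod_range_succ]
    have h2 : 1 - q ^ (3 * m + 1) ≠ 0 := one_sub_pow_ne_zero hq (by omega)
    rw [show 3 * (m + 1) + 1 = 3 * m + 4 by ring]
    field_simp

end Jackson

/-! ### Values of rational functions at algebraic points, and divisibility of numerators -/

section Value

/-- The rational function `A` is regular at `ζ`, with value `z` there. -/
def HasVal (ζ : ℂ) (A : RatFunc ℚ) (z : ℂ) : Prop :=
  ∃ a b : ℚ[X], aeval ζ b ≠ 0 ∧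
    A * algebraMap ℚ[X] (RatFunc ℚ) b = algebraMap ℚ[X] (RatFunc ℚ) a ∧
    aeval ζ a = z * aeval ζ b

namespace HasVal

variable {ζ z w : ℂ} {A B : RatFunc ℚ}

theorem ofPoly (ζ : ℂ) (a : ℚ[X]) : HasVal ζ (algebraMap ℚ[X] (RatFunc ℚ) a) (aeval ζ a) :=
  ⟨a, 1, by simp, by simp, by simp⟩

theorem one (ζ : ℂ) : HasVal ζ 1 1 := by simpa using ofPoly ζ 1

theorem zero (ζ : ℂ) : HasVal ζ 0 0 := by simpa using ofPoly ζ 0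

theorem var (ζ : ℂ) : HasVal ζ q ζ := by simpa [q, RatFunc.algebraMap_X] using ofPoly ζ X

theorem add (hA : HasVal ζ A z) (hB : HasVal ζ B w) : HasVal ζ (A + B) (z + w) := by
  obtain ⟨a, b, hb, h, hv⟩ := hA
  obtain ⟨c, d, hd, h', hv'⟩ := hB
  refine ⟨a * d + c * b, b * d, by simp [hb, hd], ?_, ?_⟩
  · simp only [map_add, map_mul, ← h, ← h']
    ring
  · simp only [map_add, map_mul, hv, hv']
    ring

theorem mul (hA : HasVal ζ A z) (hB : HasVal ζ B w) : HasVal ζ (A * B) (z * w) := by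
  obtain ⟨a, b, hb, h, hv⟩ := hA
  obtain ⟨c, d, hd, h', hv'⟩ := hB
  refine ⟨a * c, b * d, by simp [hb, hd], ?_, ?_⟩
  · simp only [map_mul, ← h, ← h']
    ring
  · simp only [map_mul, hv, hv']
    ring

theorem neg (hA : HasVal ζ A z) : HasVal ζ (-A) (-z) := by
  obtain ⟨a, b, hb, h, hv⟩ := hA
  exact ⟨-a, b, hb, by simp only [map_neg, ← h]; ring, by simp only [map_neg, hv]; ring⟩

theorem sub (hA : HasVal ζ A z) (hB : HasVal ζ B w) : HasVal ζ (A - B) (z - w) := by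
  simpa [sub_eq_add_neg] using hA.add hB.neg

theorem ne_zero (hA : HasVal ζ A z) (hz : z ≠ 0) : A ≠ 0 := by
  rintro rfl
  obtain ⟨a, b, hb, h, hv⟩ := hA
  rw [zero_mul, eq_comm, map_eq_zero_iff _ (RatFunc.algebraMap_injective ℚ)] at h
  rw [h, map_zero, eq_comm] at hv
  exact mul_ne_zero hz hb hv

theorem inv (hA : HasVal ζ A z) (hz : z ≠ 0) : HasVal ζ A⁻¹ z⁻¹ := by
  have hA0 := hA.ne_zero hz
  obtain ⟨a, b, hb, h, hv⟩ := hA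
  refine ⟨b, a, by rw [hv]; exact mul_ne_zero hz hb, ?_, ?_⟩
  · rw [← h, inv_mul_cancel_left₀ hA0]
  · rw [hv, inv_mul_cancel_left₀ hz]

theorem div (hA : HasVal ζ A z) (hB : HasVal ζ B w) (hw : w ≠ 0) : HasVal ζ (A / B) (z / w) := by
  simpa [div_eq_mul_inv] using hA.mul (hB.inv hw)

theorem pow (hA : HasVal ζ A z) (k : ℕ) : HasVal ζ (A ^ k) (z ^ k) := by
  induction k with
  | zero => simpa using one ζ
  | succ k ih => simpa [pow_succ] using ih.mul hA

theorem sum {ι : Type*} {s : Finset ι} {f : ι → RatFunc ℚ} {g : ι → ℂ}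
    (h : ∀ i ∈ s, HasVal ζ (f i) (g i)) : HasVal ζ (∑ i ∈ s, f i) (∑ i ∈ s, g i) := by
  classical
  induction s using Finset.induction_on with
  | empty => simpa using zero ζ
  | insert a s ha ih =>
    rw [Finset.sum_insert ha, Finset.sum_insert ha]
    exact (h a (Finset.mem_insert_self a s)).add
      (ih fun i hi => h i (Finset.mem_insert_of_mem hi))

theorem prod {ι : Type*} {s : Finset ι} {f : ι → RatFunc ℚ} {g : ι → ℂ}
    (h : ∀ i ∈ s, HasVal ζ (f i) (g i)) : HasVal ζ (∏ i ∈ s, f i) (∏ i ∈ s, g i) := by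
  classical
  induction s using Finset.induction_on with
  | empty => simpa using one ζ
  | insert a s ha ih =>
    rw [Finset.prod_insert ha, Finset.prod_insert ha]
    exact (h a (Finset.mem_insert_self a s)).mul
      (ih fun i hi => h i (Finset.mem_insert_of_mem hi))

theorem one_sub_pow (ζ : ℂ) (a : ℕ) : HasVal ζ (1 - q ^ a) (1 - ζ ^ a) :=
  (one ζ).sub ((var ζ).pow a)

end HasVal

/-- Divisibility of the numerator of `f C` when `C` vanishes at a primitive root of unity. -/
theorem pow_succ_dvd_num {d : ℕ} (hd : 0 < d) {ζ : ℂ} (hζ : IsPrimitiveRoot ζ d) {k : ℕ}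
    {f : ℚ[X]} (hf : cyclotomic d ℚ ^ k ∣ f) {C : RatFunc ℚ} (hC : HasVal ζ C 0) :
    cyclotomic d ℚ ^ (k + 1) ∣ (algebraMap ℚ[X] (RatFunc ℚ) f * C).num := by
  obtain ⟨a, b, hb, h, hv⟩ := hC
  rw [zero_mul] at hv
  have hmin := cyclotomic_eq_minpoly_rat hζ hd
  have ha : cyclotomic d ℚ ∣ a := by
    rw [hmin]
    exact minpoly.dvd ℚ ζ hv
  -- Φ_d is irreducible and b does not vanish at its root ζ, so the denominator cannot absorb a
  -- factor Φ_d.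
  have hcop : IsCoprime (cyclotomic d ℚ) b := by
    rw [(cyclotomic.irreducible_rat hd).coprime_iff_not_dvd]
    rintro ⟨c, rfl⟩
    apply hb
    rw [hmin, map_mul, minpoly.aeval, zero_mul]
  set A := algebraMap ℚ[X] (RatFunc ℚ) f * C with hA
  have key : A.num * b = f * a * A.denom := by
    apply RatFunc.algebraMap_injective ℚ
    rw [map_mul, map_mul, map_mul, ← h]
    have h1 := RatFunc.num_div_denom A
    rw [div_eq_iff ((map_ne_zero_iff _ (RatFunc.algebraMap_injective ℚ)).2 A.denom_ne_zero)] at h1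
    rw [h1, hA]
    ring
  refine (hcop.pow_left (m := k + 1)).dvd_of_dvd_mul_right ?_
  rw [key, pow_succ]
  exact Dvd.dvd.mul_right (mul_dvd_mul hf ha) _

theorem q_ne_zero : q ≠ 0 := RatFunc.X_ne_zero

theorem q_pow_ne_one {k : ℕ} (hk : 0 < k) : q ^ k ≠ 1 := by
  intro h
  have h1 : (X ^ k : ℚ[X]) = 1 := by
    apply RatFunc.algebraMap_injective ℚ
    simpa [q, RatFunc.algebraMap_X] using h
  have h2 := congrArg (Polynomial.eval 0) h1
  simp [hk.ne'] at h2

theorem one_sub_q_pow_ne_zero {k : ℕ} (hk : 0 < k) : 1 - q ^ k ≠ 0 :=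
  one_sub_pow_ne_zero (fun _ => q_pow_ne_one) hk

end Value

/-! ### Reflection symmetry at roots of unity -/

section Reflection

variable {F : Type*} [Field F]

/-- The partial products of `((1 - ζ ^ (3 i + 1)) / (1 - ζ ^ (3 i + 3))) ^ 2`. -/
def sqProd (ζ : F) (k : ℕ) : F :=
  ∏ i ∈ Finset.range k, ((1 - ζ ^ (3 * i + 1)) / (1 - ζ ^ (3 * i + 3))) ^ 2

/-- The function `z / (1 - z) ^ 2`, which is invariant under `z ↦ z⁻¹`. -/
def koebe (z : F) : F := z / (1 - z) ^ 2

/-- The logarithmic derivative of the deformed product. -/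
def koebeSum (ζ : F) (k : ℕ) : F :=
  ∑ i ∈ Finset.range k, (koebe (ζ ^ (3 * i + 1)) - koebe (ζ ^ (3 * i + 3)))

theorem koebe_eq_of_mul_eq_one {z w : F} (h : z * w = 1) : koebe z = koebe w := by
  have hz : z ≠ 0 := left_ne_zero_of_mul_eq_one h
  obtain rfl : w = z⁻¹ := eq_inv_of_mul_eq_one_right h
  unfold koebe
  by_cases h1 : 1 - z = 0
  · have : z = 1 := by linear_combination -h1
    simp [this]
  · have h2 : 1 - z⁻¹ ≠ 0 := by
      intro h3
      apply h1
      field_simp at h3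
      linear_combination -h3
    rw [div_eq_div_iff (pow_ne_zero 2 h1) (pow_ne_zero 2 h2)]
    field_simp
    ring

variable {ζ : F} {r : ℕ}

theorem pow_mul_reflect (hr : ζ ^ (3 * r + 1) = 1) {i j : ℕ} (hij : i + j + 1 = r) :
    ζ ^ (3 * i + 1) * ζ ^ (3 * j + 3) = 1 := by
  rw [← pow_add, ← hr]
  congr 1
  omega

theorem koebeSum_self (hr : ζ ^ (3 * r + 1) = 1) : koebeSum ζ r = 0 := by
  rw [koebeSum, Finset.sum_sub_distrib, sub_eq_zero,
    ← Finset.sum_range_reflect (fun i => koebe (ζ ^ (3 * i + 3)))]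
  refine Finset.sum_congr rfl fun i hi => koebe_eq_of_mul_eq_one (pow_mul_reflect hr ?_)
  have := Finset.mem_range.1 hi
  omega

/-- Lowering l by one and raising k by one exchanges terms at mutually inverse arguments, on which
`koebe` agrees; the base case is the full sum, which cancels in pairs. -/
theorem koebeSum_reflect (hr : ζ ^ (3 * r + 1) = 1) {k l : ℕ} (hkl : k + l = r) :
    koebeSum ζ l = koebeSum ζ k := by
  induction k generalizing l with
  | zero =>
    obtain rfl : l = r := by omega
    rw [koebeSum_self hr]
    simp [koebeSum]
  | succ k ih =>
    have h := ih (l := l + 1) (by omega)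
    have h1 := koebe_eq_of_mul_eq_one (pow_mul_reflect hr (i := l) (j := k) (by omega))
    have h2 := koebe_eq_of_mul_eq_one (pow_mul_reflect hr (i := k) (j := l) (by omega))
    simp only [koebeSum, Finset.sum_range_succ] at h ⊢
    linear_combination h - h1 - h2

theorem one_sub_sq_of_mul_eq_one {z w : F} (h : z * w = 1) : (1 - z) ^ 2 = z ^ 2 * (1 - w) ^ 2 := by
  linear_combination (2 * z - z * w - 1) * h

/-- The exponents add up to r(3r+1), so the product is 1 once ζ^(3r+1) = 1. -/
theorem prod_pow_reflect (ζ : F) (r : ℕ) :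
    ∏ i ∈ Finset.range r, ζ ^ (6 * i + 4) = (ζ ^ (3 * r + 1)) ^ r := by
  induction r with
  | zero => simp
  | succ r ih =>
    rw [Finset.prod_range_succ, ih]
    ring

theorem sqProd_self (hr : ζ ^ (3 * r + 1) = 1) (h0 : ∀ i < r, 1 - ζ ^ (3 * i + 3) ≠ 0) :
    ζ ^ (2 * r) * sqProd ζ r = 1 := by
  have h1 : ∏ i ∈ Finset.range r, (1 - ζ ^ (3 * i + 3)) ^ 2 ≠ 0 :=
    Finset.prod_ne_zero_iff.2 fun i hi => pow_ne_zero 2 (h0 i (Finset.mem_range.1 hi))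
  have h2 : ∏ i ∈ Finset.range r, (1 - ζ ^ (3 * i + 1)) ^ 2 =
      (∏ i ∈ Finset.range r, (ζ ^ (3 * i + 1)) ^ 2) *
        ∏ i ∈ Finset.range r, (1 - ζ ^ (3 * i + 3)) ^ 2 := by
    rw [← Finset.prod_range_reflect (fun i => (1 - ζ ^ (3 * i + 3)) ^ 2), ← Finset.prod_mul_distrib]
    refine Finset.prod_congr rfl fun i hi => one_sub_sq_of_mul_eq_one (pow_mul_reflect hr ?_)
    have := Finset.mem_range.1 hi
    omega
  have h3 : ζ ^ (2 * r) * ∏ i ∈ Finset.range r, (ζ ^ (3 * i + 1)) ^ 2 = 1 := by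
    have h := prod_pow_reflect ζ r
    have h' : ζ ^ (2 * r) = ∏ _i ∈ Finset.range r, ζ ^ 2 := by simp [pow_mul]
    rw [hr, one_pow] at h
    rw [← h, h', ← Finset.prod_mul_distrib]
    refine Finset.prod_congr rfl fun i _ => ?_
    ring
  simp only [sqProd, div_pow, Finset.prod_div_distrib]
  rw [h2, mul_div_cancel_right₀ _ h1, h3]

/-- Each inductive step moves one factor from l to k; by the pairing of inverse arguments the two
factors involved multiply to ζ^(-4). -/
theorem sqProd_reflect (hr : ζ ^ (3 * r + 1) = 1) (h0 : ∀ i < r, 1 - ζ ^ (3 * i + 3) ≠ 0)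
    {k l : ℕ} (hkl : k + l = r) :
    ζ ^ (2 * r) * sqProd ζ l = ζ ^ (4 * k) * sqProd ζ k := by
  induction k generalizing l with
  | zero =>
    obtain rfl : l = r := by omega
    rw [sqProd_self hr h0]
    simp [sqProd]
  | succ k ih =>
    have h := ih (l := l + 1) (by omega)
    have h1 := pow_mul_reflect hr (i := l) (j := k) (by omega)
    have h2 := pow_mul_reflect hr (i := k) (j := l) (by omega)
    have hk := h0 k (by omega)
    have hl := h0 l (by omega)
    have e1 := one_sub_sq_of_mul_eq_one h1
    have e2 := one_sub_sq_of_mul_eq_one h2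
    have hz : ζ ^ (3 * k + 3) ≠ 0 := right_ne_zero_of_mul_eq_one h1
    have hφ : ((1 - ζ ^ (3 * l + 1)) / (1 - ζ ^ (3 * l + 3))) ^ 2 *
        ((1 - ζ ^ (3 * k + 1)) / (1 - ζ ^ (3 * k + 3))) ^ 2 * ζ ^ 4 = 1 := by
      rw [div_pow, div_pow, e1, e2]
      have : ζ ^ (3 * l + 1) = (ζ ^ (3 * k + 3))⁻¹ := eq_inv_of_mul_eq_one_left h1
      rw [this]
      field_simp
      ring
    have hne : ((1 - ζ ^ (3 * l + 1)) / (1 - ζ ^ (3 * l + 3))) ^ 2 ≠ 0 := by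
      intro h3
      rw [h3, zero_mul, zero_mul] at hφ
      exact zero_ne_one hφ
    simp only [sqProd, Finset.prod_range_succ] at h ⊢
    apply mul_right_cancel₀ hne
    rw [show 4 * (k + 1) = 4 * k + 4 by ring, pow_add ζ (4 * k) 4]
    linear_combination h - ζ ^ (4 * k) * (∏ i ∈ Finset.range k,
      ((1 - ζ ^ (3 * i + 1)) / (1 - ζ ^ (3 * i + 3))) ^ 2) * hφ

/-- The well-poised sum at a root of unity vanishes, with any reflection-invariant weight. -/
theorem sum_reflect_eq_zero [CharZero F] (hr : ζ ^ (3 * r + 1) = 1)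
    (h0 : ∀ i < r, 1 - ζ ^ (3 * i + 3) ≠ 0) (ψ : ℕ → F) (hψ : ∀ k l, k + l = r → ψ l = ψ k) :
    ∑ k ∈ Finset.range (r + 1), (1 - ζ ^ (6 * k + 1)) * ζ ^ (3 * k) * sqProd ζ k ^ 3 * ψ k = 0 := by
  have hζ : ζ ≠ 0 := by
    rintro rfl
    simp at hr
  set T : ℕ → F := fun k => (1 - ζ ^ (6 * k + 1)) * ζ ^ (3 * k) * sqProd ζ k ^ 3 * ψ k with hT
  have key : ∀ k l, k + l = r → T l = -T k := by
    intro k l hkl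
    have h1 := sqProd_reflect hr h0 hkl
    have h2 : ζ ^ (6 * r) * sqProd ζ l ^ 3 = ζ ^ (12 * k) * sqProd ζ k ^ 3 := by
      calc ζ ^ (6 * r) * sqProd ζ l ^ 3 = (ζ ^ (2 * r) * sqProd ζ l) ^ 3 := by ring
        _ = _ := by rw [h1]; ring
    have h3 : ζ ^ (6 * k + 1) * ζ ^ (6 * l + 1) = 1 := by
      calc ζ ^ (6 * k + 1) * ζ ^ (6 * l + 1) = (ζ ^ (3 * r + 1)) ^ 2 := by rw [← hkl]; ring
        _ = 1 := by rw [hr, one_pow]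
    have h4 : ζ ^ (6 * k + 1) * (ζ ^ (6 * r) * ζ ^ (3 * k)) =
        ζ ^ (3 * l) * ζ ^ (12 * k) * ζ ^ (3 * r + 1) := by
      rw [← hkl]
      ring
    rw [hr, mul_one] at h4
    apply mul_left_cancel₀ (mul_ne_zero (pow_ne_zero (6 * r) hζ) (pow_ne_zero (6 * k + 1) hζ))
    simp only [hT, hψ k l hkl]
    linear_combination (ζ ^ (6 * k + 1) - 1) * ζ ^ (3 * l) * ψ k * h2 -
      ζ ^ (3 * l) * ζ ^ (6 * r) * sqProd ζ l ^ 3 * ψ k * h3 +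
      (1 - ζ ^ (6 * k + 1)) * sqProd ζ k ^ 3 * ψ k * h4
  have hs : ∑ k ∈ Finset.range (r + 1), T k = -∑ k ∈ Finset.range (r + 1), T k := by
    conv_lhs => rw [← Finset.sum_range_reflect]
    rw [← Finset.sum_neg_distrib]
    refine Finset.sum_congr rfl fun i hi => key _ _ ?_
    have := Finset.mem_range.1 hi
    omega
  exact self_eq_neg.1 hs

end Reflection

/-! ### Vanishing at roots of unity of order d, by blocks of length d -/

section Blocks

/-- The ratio `(q ^ a; q ^ 3)_k / (q ^ 3; q ^ 3)_k`. -/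
noncomputable def ratProd (a k : ℕ) : RatFunc ℚ :=
  ∏ i ∈ Finset.range k, (1 - q ^ (3 * i + a)) / (1 - q ^ (3 * i + 3))

theorem qPoch_div_qPoch (a k : ℕ) :
    qPoch (q ^ a) (q ^ 3) k / qPoch (q ^ 3) (q ^ 3) k = ratProd a k := by
  simp only [qPoch, ratProd, ← Finset.prod_div_distrib, ← pow_mul, ← pow_add, add_comm]

variable {d : ℕ} {ζ : ℂ}

theorem one_sub_pow_ne_zero_of_not_dvd (hζ : IsPrimitiveRoot ζ d) {a : ℕ} (ha : ¬d ∣ a) :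
    1 - ζ ^ a ≠ 0 := fun h => ha ((hζ.pow_eq_one_iff_dvd a).1 (by linear_combination -h))

theorem hasVal_div_of_dvd (hd : 0 < d) (hζ : IsPrimitiveRoot ζ d) {a b : ℕ} (ha : d ∣ a)
    (hb : d ∣ b) (hb0 : 0 < b) : ∃ v, HasVal ζ ((1 - q ^ a) / (1 - q ^ b)) v := by
  obtain ⟨α, rfl⟩ := ha
  obtain ⟨β, rfl⟩ := hb
  have hβ : β ≠ 0 := by
    rintro rfl
    simp at hb0
  have h1 : ∀ α : ℕ, HasVal ζ (∑ i ∈ Finset.range α, (q ^ d) ^ i) α := by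
    intro α
    have := HasVal.sum (s := Finset.range α) (fun i _ => ((HasVal.var ζ).pow d).pow i)
    simpa [hζ.pow_eq_one] using this
  rw [pow_mul, pow_mul, ← geom_sum_mul_neg (q ^ d) α, ← geom_sum_mul_neg (q ^ d) β,
    mul_div_mul_right _ _ (one_sub_q_pow_ne_zero hd)]
  exact ⟨_, (h1 α).div (h1 β) (Nat.cast_ne_zero.2 hβ)⟩

theorem not_dvd_three_mul (h3 : d.Coprime 3) {l i : ℕ} (hi : i + 1 < d) :
    ¬d ∣ 3 * (l * d + i) + 3 := by
  intro h
  have h1 : d ∣ l * d + i + 1 := h3.dvd_of_dvd_mul_left (by simpa [mul_add] using h)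
  rw [add_assoc, Nat.dvd_add_right (dvd_mul_left d l)] at h1
  exact absurd (Nat.le_of_dvd (Nat.succ_pos i) h1) (by omega)

theorem exists_dvd_three_mul_add (hd : 0 < d) (h3 : d.Coprime 3) (a : ℕ) :
    ∃ r < d, d ∣ 3 * r + a := by
  have : NeZero d := ⟨hd.ne'⟩
  have hu : IsUnit ((3 : ℕ) : ZMod d) := (ZMod.isUnit_iff_coprime 3 d).2 h3.symm
  obtain ⟨u, hu⟩ := hu
  refine ⟨(-(↑u⁻¹ : ZMod d) * a).val, ZMod.val_lt _, ?_⟩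
  rw [← ZMod.natCast_eq_zero_iff]
  push_cast
  rw [ZMod.natCast_zmod_val]
  have h : ((3 : ℕ) : ZMod d) * (↑u⁻¹ : ZMod d) = 1 := by rw [← hu, Units.mul_inv]
  push_cast at h
  linear_combination -(a : ZMod d) * h

/-- Within a block only the last denominator vanishes at ζ, since d is prime to 3. Some numerator
vanishes there too, and the quotient of the two is regular. -/
theorem hasVal_block (hd : 0 < d) (hζ : IsPrimitiveRoot ζ d) (h3 : d.Coprime 3) (a l : ℕ) :
    ∃ v, HasVal ζ (∏ i ∈ Finset.range d,
      (1 - q ^ (3 * (l * d + i) + a)) / (1 - q ^ (3 * (l * d + i) + 3))) v := by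
  obtain ⟨e, rfl⟩ := Nat.exists_eq_succ_of_ne_zero hd.ne'
  obtain ⟨r, hr, hdvd⟩ := exists_dvd_three_mul_add hd h3 a
  rw [Finset.prod_div_distrib, Finset.prod_range_succ (fun i => 1 - q ^ (3 * (l * (e + 1) + i) + 3)),
    ← Finset.mul_prod_erase _ _ (Finset.mem_range.2 hr), mul_comm (∏ i ∈ Finset.range e, _),
    mul_div_mul_comm]
  have h1 : e + 1 ∣ 3 * (l * (e + 1) + r) + a := by
    rw [mul_add, add_assoc]
    exact (Nat.dvd_add_right (Dvd.dvd.mul_left (dvd_mul_left _ _) _)).2 hdvd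
  have h2 : e + 1 ∣ 3 * (l * (e + 1) + e) + 3 := ⟨3 * (l + 1), by ring⟩
  obtain ⟨v, hv⟩ := hasVal_div_of_dvd hd hζ h1 h2 (by omega)
  refine ⟨_, hv.mul ((HasVal.prod fun i _ => HasVal.one_sub_pow ζ _).div
    (HasVal.prod fun i _ => HasVal.one_sub_pow ζ _) ?_)⟩
  refine Finset.prod_ne_zero_iff.2 fun i hi => one_sub_pow_ne_zero_of_not_dvd hζ ?_
  exact not_dvd_three_mul h3 (by simpa using Finset.mem_range.1 hi)

theorem hasVal_ratProd_mul (hd : 0 < d) (hζ : IsPrimitiveRoot ζ d) (h3 : d.Coprime 3) (a l : ℕ) :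
    ∃ v, HasVal ζ (ratProd a (l * d)) v := by
  induction l with
  | zero => exact ⟨1, by simpa [ratProd] using HasVal.one ζ⟩
  | succ l ih =>
    obtain ⟨v, hv⟩ := ih
    obtain ⟨w, hw⟩ := hasVal_block hd hζ h3 a l
    refine ⟨v * w, ?_⟩
    rw [ratProd, add_mul, one_mul, Finset.prod_range_add]
    exact hv.mul hw

theorem hasVal_ratProd_add (hζ : IsPrimitiveRoot ζ d) (h3 : d.Coprime 3) {a l s : ℕ} {v : ℂ}
    (hv : HasVal ζ (ratProd a (l * d)) v) (hs : s < d) :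
    HasVal ζ (ratProd a (l * d + s))
      (v * ∏ i ∈ Finset.range s, (1 - ζ ^ (3 * i + a)) / (1 - ζ ^ (3 * i + 3))) := by
  rw [ratProd, Finset.prod_range_add]
  refine hv.mul (HasVal.prod fun i hi => ?_)
  have hper : ∀ b, ζ ^ (3 * (l * d + i) + b) = ζ ^ (3 * i + b) := by
    intro b
    rw [show 3 * (l * d + i) + b = d * (3 * l) + (3 * i + b) by ring, pow_add, pow_mul,
      hζ.pow_eq_one, one_pow, one_mul]
  have h1 := HasVal.one_sub_pow ζ (3 * (l * d + i) + a)
  have h2 := HasVal.one_sub_pow ζ (3 * (l * d + i) + 3)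
  have hne := one_sub_pow_ne_zero_of_not_dvd hζ
    (not_dvd_three_mul h3 (l := l) (i := i) (by have := Finset.mem_range.1 hi; omega))
  rw [hper] at h1 h2 hne
  exact h1.div h2 hne

theorem hasVal_ratProd (hd : 0 < d) (hζ : IsPrimitiveRoot ζ d) (h3 : d.Coprime 3) (a k : ℕ) :
    ∃ v, HasVal ζ (ratProd a k) v := by
  obtain ⟨v, hv⟩ := hasVal_ratProd_mul hd hζ h3 a (k / d)
  have := hasVal_ratProd_add hζ h3 hv (Nat.mod_lt k hd)
  rw [Nat.div_add_mod'] at this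
  exact ⟨_, this⟩

/-- The summand of the truncated series. -/
noncomputable def wpTerm (k : ℕ) : RatFunc ℚ :=
  qInt (6 * k + 1) * ratProd 1 k ^ 6 * q ^ (3 * k)

/-- By periodicity the block is, at ζ, a constant multiple of the initial one. Its terms beyond r
contain 1 - ζ^(3r+1) = 0, and the rest cancel by reflection. -/
theorem hasVal_sum_block (hd : 1 < d) (hζ : IsPrimitiveRoot ζ d) (h3 : d.Coprime 3)
    {r : ℕ} (hr : d ∣ 3 * r + 1) (l : ℕ) {s : ℕ} (hrs : r < s) (hs : s ≤ d) :
    HasVal ζ (∑ i ∈ Finset.range s, wpTerm (l * d + i)) 0 := by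
  obtain ⟨v, hv⟩ := hasVal_ratProd_mul (by omega) hζ h3 1 l
  have h1 : 1 - ζ ≠ 0 := by
    simpa using one_sub_pow_ne_zero_of_not_dvd hζ (a := 1) (by simpa using hd.ne')
  have hr1 : ζ ^ (3 * r + 1) = 1 := (hζ.pow_eq_one_iff_dvd _).2 hr
  have hterm : ∀ i ∈ Finset.range s, HasVal ζ (wpTerm (l * d + i))
      (v ^ 6 / (1 - ζ) * ((1 - ζ ^ (6 * i + 1)) * ζ ^ (3 * i) * sqProd ζ i ^ 3 * 1)) := by
    intro i hi
    have hper : ∀ b c, ζ ^ (b * (l * d + i) + c) = ζ ^ (b * i + c) := by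
      intro b c
      rw [show b * (l * d + i) + c = d * (b * l) + (b * i + c) by ring, pow_add, pow_mul,
        hζ.pow_eq_one, one_pow, one_mul]
    have e1 := HasVal.one_sub_pow ζ (6 * (l * d + i) + 1)
    have e2 := (HasVal.var ζ).pow (3 * (l * d + i))
    have e3 := (hasVal_ratProd_add hζ h3 hv (lt_of_lt_of_le (Finset.mem_range.1 hi) hs)).pow 6
    rw [hper] at e1
    rw [show ζ ^ (3 * (l * d + i)) = ζ ^ (3 * i) from hper 3 0] at e2
    have h : HasVal ζ (wpTerm (l * d + i)) _ :=
      ((e1.div ((HasVal.one ζ).sub (HasVal.var ζ)) h1).mul e3).mul e2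
    convert h using 1
    rw [sqProd, Finset.prod_pow]
    ring
  have hsum := HasVal.sum hterm
  rw [← Finset.mul_sum] at hsum
  have hsub : Finset.range (r + 1) ⊆ Finset.range s := Finset.range_subset_range.2 hrs
  rw [← Finset.sum_subset (f := fun i => (1 - ζ ^ (6 * i + 1)) * ζ ^ (3 * i) * sqProd ζ i ^ 3 * 1)
    hsub, sum_reflect_eq_zero hr1 _ (fun _ => 1) (fun _ _ _ => rfl),
    mul_zero] at hsum
  · exact hsum
  · intro i hi
    simpa using one_sub_pow_ne_zero_of_not_dvd hζ
      (not_dvd_three_mul h3 (l := 0) (i := i) (by omega))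
  · intro i _ hi
    have hri : r ∈ Finset.range i := by simpa using hi
    rw [sqProd, Finset.prod_eq_zero hri (by rw [hr1]; simp)]
    simp

theorem hasVal_sum_mul (hd : 1 < d) (hζ : IsPrimitiveRoot ζ d) (h3 : d.Coprime 3)
    {r : ℕ} (hr : d ∣ 3 * r + 1) (hrd : r < d) (l : ℕ) :
    HasVal ζ (∑ i ∈ Finset.range (l * d), wpTerm i) 0 := by
  induction l with
  | zero => simpa using HasVal.zero ζ
  | succ l ih =>
    rw [add_mul, one_mul, Finset.sum_range_add]
    simpa using ih.add (hasVal_sum_block hd hζ h3 hr l hrd le_rfl)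

/-- Both truncations of the series vanish at every primitive root of unity of order dividing
`3 m + 1`. -/
theorem hasVal_sum (hd : 1 < d) (hζ : IsPrimitiveRoot ζ d) {m M : ℕ} (hdm : d ∣ 3 * m + 1)
    (hM : M = m ∨ M = 3 * m) : HasVal ζ (∑ k ∈ Finset.range (M + 1), wpTerm k) 0 := by
  have h3 : d.Coprime 3 := Nat.Coprime.coprime_dvd_left hdm (by simp)
  have hr : d ∣ 3 * (m % d) + 1 := by
    have h : 3 * m + 1 = d * (3 * (m / d)) + (3 * (m % d) + 1) := by
      conv_lhs => rw [← Nat.div_add_mod m d]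
      ring
    rw [h] at hdm
    exact (Nat.dvd_add_right (dvd_mul_right _ _)).1 hdm
  have hrd : m % d < d := Nat.mod_lt _ (by omega)
  rcases hM with rfl | rfl
  -- The last, partial block ends exactly at the index r = m mod d, just far enough for the
  -- reflection.
  · rw [← Nat.div_add_mod' M d, add_assoc, Finset.sum_range_add]
    simpa using (hasVal_sum_mul hd hζ h3 hr hrd (M / d)).add
      (hasVal_sum_block hd hζ h3 hr (M / d) (Nat.lt_succ_self _) hrd)
  -- Here M + 1 = 3m+1 is a multiple of d, so only full blocks occur.
  · obtain ⟨e, he⟩ := hdm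
    rw [he, mul_comm]
    exact hasVal_sum_mul hd hζ h3 hr hrd e

end Blocks

/-! ### The deformation in U and its closed form -/

section Deformation

variable {K : Type*} [Field K]

theorem one_sub_sq_add {z U : K} (hz : 1 - z ≠ 0) :
    (1 - z) ^ 2 + U * z = (1 - z) ^ 2 * (1 + U * koebe z) := by
  rw [koebe]
  field_simp

/-- The deformed factor, normalised to `1` at `U = 0`. -/
def deform (q U : K) (a k : ℕ) : K :=
  ∏ i ∈ Finset.range k, (1 + U * koebe (q ^ (3 * i + a))) / (1 + U * koebe (q ^ (3 * i + 3)))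

/-- The value of the deformation parameter at which the series terminates. -/
def termParam (q : K) (m : ℕ) : K := -((1 - q ^ (3 * m + 1)) ^ 2 / q ^ (3 * m + 1))

variable {q : K}

theorem deform_zero (q : K) (a k : ℕ) : deform q 0 a k = 1 := by simp [deform]

theorem admissible_zero (hq : ∀ k, 0 < k → q ^ k ≠ 1) : Admissible q 0 := by
  intro i
  simpa using one_sub_pow_ne_zero hq (a := 3 * i + 3) (by omega)

/-- This is (1-z)^2 + Uz = (1-az)(1-z/a) with a = q^(3m+1). -/
theorem termParam_bottom (hq0 : q ≠ 0) (m i : ℕ) :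
    (1 - q ^ (3 * i + 3)) ^ 2 + termParam q m * q ^ (3 * i + 3) =
      (1 - q ^ (3 * m + 3 * i + 4)) * (q ^ (3 * m) - q ^ (3 * i + 2)) / q ^ (3 * m) := by
  rw [termParam]
  have h := pow_ne_zero (3 * m) hq0
  rw [show q ^ (3 * m + 1) = q ^ (3 * m) * q by ring,
    show q ^ (3 * m + 3 * i + 4) = q ^ (3 * m) * q ^ (3 * i) * q ^ 4 by ring,
    show q ^ (3 * i + 3) = q ^ (3 * i) * q ^ 3 by ring,
    show q ^ (3 * i + 2) = q ^ (3 * i) * q ^ 2 by ring]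
  generalize q ^ (3 * m) = M at *
  generalize q ^ (3 * i) = y
  field_simp
  ring

theorem termParam_top (hq0 : q ≠ 0) (m i : ℕ) :
    (1 - q ^ (3 * i + 1)) ^ 2 + termParam q m * q ^ (3 * i + 1) =
      (q ^ (3 * m) - q ^ (3 * i)) * (1 - q ^ (3 * m + 3 * i + 2)) / q ^ (3 * m) := by
  rw [termParam]
  have h := pow_ne_zero (3 * m) hq0
  rw [show q ^ (3 * m + 1) = q ^ (3 * m) * q by ring,
    show q ^ (3 * m + 3 * i + 2) = q ^ (3 * m) * q ^ (3 * i) * q ^ 2 by ring,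
    show q ^ (3 * i + 1) = q ^ (3 * i) * q by ring]
  generalize q ^ (3 * m) = M at *
  generalize q ^ (3 * i) = y
  field_simp
  ring

theorem admissible_termParam (hq0 : q ≠ 0) (hq : ∀ k, 0 < k → q ^ k ≠ 1) (m : ℕ) :
    Admissible q (termParam q m) := by
  intro i
  rw [termParam_bottom hq0]
  exact div_ne_zero (mul_ne_zero (one_sub_pow_ne_zero hq (by omega))
    (pow_sub_pow_ne_zero hq0 hq (by omega))) (pow_ne_zero _ hq0)

theorem prod_termRatio_eq (hq0 : q ≠ 0) (hq : ∀ k, 0 < k → q ^ k ≠ 1) (m k : ℕ) :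
    ∏ i ∈ Finset.range k, termRatio q m i = sqProd q k * deform q (termParam q m) 1 k := by
  rw [sqProd, deform, ← Finset.prod_mul_distrib]
  refine Finset.prod_congr rfl fun i _ => ?_
  rw [div_pow, div_mul_div_comm, ← one_sub_sq_add (one_sub_pow_ne_zero hq (by omega)),
    ← one_sub_sq_add (one_sub_pow_ne_zero hq (by omega)), termParam_top hq0, termParam_bottom hq0,
    div_div_div_cancel_right₀ (pow_ne_zero _ hq0), termRatio]

theorem prod_wpRatio_eq (hq : ∀ k, 0 < k → q ^ k ≠ 1) (U : K) (k : ℕ) :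
    ∏ i ∈ Finset.range k, wpRatio q U i = sqProd q k ^ 2 * deform q U 1 k := by
  rw [sqProd, deform, ← Finset.prod_pow, ← Finset.prod_mul_distrib]
  refine Finset.prod_congr rfl fun i _ => ?_
  rw [wpRatio, one_sub_sq_add (one_sub_pow_ne_zero hq (by omega)),
    one_sub_sq_add (one_sub_pow_ne_zero hq (by omega)), mul_div_mul_comm, mul_div_mul_comm, ← div_pow]
  ring

theorem prod_sumRatio_eq (hq : ∀ k, 0 < k → q ^ k ≠ 1) (U : K) (k : ℕ) :
    ∏ i ∈ Finset.range k, sumRatio q U i =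
      (∏ i ∈ Finset.range k, (1 - q ^ (3 * i + 2)) / (1 - q ^ (3 * i + 3))) ^ 3 *
        deform q U 2 k := by
  rw [deform, ← Finset.prod_pow, ← Finset.prod_mul_distrib]
  refine Finset.prod_congr rfl fun i _ => ?_
  rw [sumRatio, one_sub_sq_add (one_sub_pow_ne_zero hq (by omega)),
    one_sub_sq_add (one_sub_pow_ne_zero hq (by omega)), mul_div_mul_comm, mul_div_mul_comm, ← div_pow]
  ring

/-- The deformed series has a closed form when one of its two parameters terminates it. -/
theorem sum_deform (hq0 : q ≠ 0) (hq : ∀ k, 0 < k → q ^ k ≠ 1) {U : K}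
    (hU : Admissible q U) (m : ℕ) :
    ∑ k ∈ Finset.range (m + 1), (1 - q ^ (6 * k + 1)) * q ^ (3 * k) * sqProd q k ^ 3 *
        (deform q U 1 k * deform q (termParam q m) 1 k) =
      (1 - q ^ (3 * m + 1)) *
        ((∏ i ∈ Finset.range m, (1 - q ^ (3 * i + 2)) / (1 - q ^ (3 * i + 3))) ^ 3 *
          deform q U 2 m) := by
  rw [← prod_sumRatio_eq hq, ← sum_jacksonTerm hq0 hq hU]
  refine Finset.sum_congr rfl fun k _ => ?_
  rw [jacksonTerm, prod_wpRatio_eq hq, prod_termRatio_eq hq0 hq]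
  ring

end Deformation

/-! ### Second-order expansion at a primitive n-th root of unity -/

section Local

variable {ζ : ℂ}

/-- Second-order expansion of a deformed product at a zero of the deformation parameter. -/
theorem prod_expand {U : RatFunc ℚ} (hU : HasVal ζ U 0) {a b : ℕ → RatFunc ℚ} {α β : ℕ → ℂ} (k : ℕ)
    (ha : ∀ i < k, HasVal ζ (a i) (α i)) (hb : ∀ i < k, HasVal ζ (b i) (β i)) :
    ∃ E e, HasVal ζ E e ∧ ∏ i ∈ Finset.range k, (1 + U * a i) / (1 + U * b i) =
      1 + U * ∑ i ∈ Finset.range k, (a i - b i) + U ^ 2 * E := by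
  induction k with
  | zero => exact ⟨0, 0, HasVal.zero ζ, by simp⟩
  | succ k ih =>
    obtain ⟨E, e, hE, hprod⟩ := ih (fun i hi => ha i (by omega)) (fun i hi => hb i (by omega))
    have hak := ha k (by omega)
    have hbk := hb k (by omega)
    have hS := HasVal.sum (s := Finset.range k) fun i hi =>
      (ha i (by have := Finset.mem_range.1 hi; omega)).sub
        (hb i (by have := Finset.mem_range.1 hi; omega))
    have hden : HasVal ζ (1 + U * b k) 1 := by
      simpa using (HasVal.one ζ).add (hU.mul hbk)
    have hden0 := hden.ne_zero one_ne_zero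
    have hq := (hbk.mul (hak.sub hbk)).neg.div hden one_ne_zero
    refine ⟨_, _, ((hE.add (hS.mul (hak.sub hbk))).add hq).add
      ((hU.mul ((hE.mul (hak.sub hbk)).add (hS.mul hq))).add ((hU.pow 2).mul (hE.mul hq))), ?_⟩
    have hf : (1 + U * a k) / (1 + U * b k) =
        1 + U * (a k - b k) + U ^ 2 * (-(b k * (a k - b k)) / (1 + U * b k)) := by
      field_simp
      ring
    rw [Finset.prod_range_succ, Finset.sum_range_succ, hprod, hf]
    ring

theorem hasVal_koebe {a : ℕ} (ha : 1 - ζ ^ a ≠ 0) :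
    HasVal ζ (koebe (q ^ a)) (koebe (ζ ^ a)) :=
  ((HasVal.var ζ).pow a).div ((HasVal.one_sub_pow ζ a).pow 2) (pow_ne_zero 2 ha)

variable {m : ℕ}

theorem hasVal_termParam (hζ : IsPrimitiveRoot ζ (3 * m + 1)) :
    HasVal ζ (termParam q m) 0 := by
  have h := (((HasVal.one_sub_pow ζ (3 * m + 1)).pow 2).div ((HasVal.var ζ).pow (3 * m + 1))
    (by rw [hζ.pow_eq_one]; exact one_ne_zero)).neg
  rw [hζ.pow_eq_one] at h
  simpa [termParam] using h

theorem one_sub_root_pow_ne_zero (hζ : IsPrimitiveRoot ζ (3 * m + 1)) {a : ℕ} (ha : 0 < a)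
    (ham : a < 3 * m + 1) : 1 - ζ ^ a ≠ 0 :=
  one_sub_pow_ne_zero_of_not_dvd hζ fun h => absurd (Nat.le_of_dvd ha h) (by omega)

theorem deform_expand (hζ : IsPrimitiveRoot ζ (3 * m + 1)) {a k : ℕ} (ha : 0 < a) (ha3 : a ≤ 3)
    (hk : k ≤ m) :
    ∃ E e, HasVal ζ E e ∧ deform q (termParam q m) a k =
      1 + termParam q m *
        ∑ i ∈ Finset.range k, (koebe (q ^ (3 * i + a)) - koebe (q ^ (3 * i + 3))) +
        termParam q m ^ 2 * E :=
  prod_expand (hasVal_termParam hζ) k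
    (fun _ _ => hasVal_koebe (one_sub_root_pow_ne_zero hζ (by omega) (by omega)))
    (fun _ _ => hasVal_koebe (one_sub_root_pow_ne_zero hζ (by omega) (by omega)))

theorem hasVal_sqProd (hζ : IsPrimitiveRoot ζ (3 * m + 1)) {k : ℕ} (hk : k ≤ m) :
    HasVal ζ (sqProd q k) (sqProd ζ k) := by
  refine HasVal.prod fun i hi => HasVal.pow ?_ 2
  have := Finset.mem_range.1 hi
  exact (HasVal.one_sub_pow ζ _).div (HasVal.one_sub_pow ζ _)
    (one_sub_root_pow_ne_zero hζ (by omega) (by omega))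

theorem hasVal_koebeSum (hζ : IsPrimitiveRoot ζ (3 * m + 1)) {k : ℕ} (hk : k ≤ m) :
    HasVal ζ (koebeSum q k) (koebeSum ζ k) := by
  refine HasVal.sum fun i hi => ?_
  have := Finset.mem_range.1 hi
  exact (hasVal_koebe (one_sub_root_pow_ne_zero hζ (by omega) (by omega))).sub
    (hasVal_koebe (one_sub_root_pow_ne_zero hζ (by omega) (by omega)))

/-- The truncated series, up to a multiple of `(1 - q ^ n) ^ 4` by a function vanishing at `ζ`. -/
theorem exists_sum_eq (hζ : IsPrimitiveRoot ζ (3 * m + 1)) :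
    ∃ Ω, HasVal ζ Ω 0 ∧
      ∑ k ∈ Finset.range (m + 1), (1 - q ^ (6 * k + 1)) * q ^ (3 * k) * sqProd q k ^ 3 =
        (1 - q ^ (3 * m + 1)) * ratProd 2 m ^ 3 * (2 - deform q (termParam q m) 2 m) +
          termParam q m ^ 2 * Ω := by
  have hX := hasVal_termParam hζ
  have hexp : ∀ k, ∃ E e, k ≤ m → HasVal ζ E e ∧ deform q (termParam q m) 1 k =
      1 + termParam q m * koebeSum q k + termParam q m ^ 2 * E := by
    intro k
    by_cases hk : k ≤ m
    · obtain ⟨E, e, h⟩ := deform_expand hζ one_pos (by norm_num) hk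
      exact ⟨E, e, fun _ => h⟩
    · exact ⟨0, 0, fun h => absurd h hk⟩
  choose E e hE using hexp
  refine ⟨∑ k ∈ Finset.range (m + 1), (1 - q ^ (6 * k + 1)) * q ^ (3 * k) * sqProd q k ^ 3 *
    (koebeSum q k + termParam q m * E k) ^ 2, ?_, ?_⟩
  · have h := sum_reflect_eq_zero hζ.pow_eq_one
      (fun i hi => one_sub_root_pow_ne_zero hζ (a := 3 * i + 3) (by omega) (by omega))
      (fun k => koebeSum ζ k ^ 2) (fun k l hkl => by rw [koebeSum_reflect hζ.pow_eq_one hkl])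
    rw [← h]
    refine HasVal.sum fun k hk => ?_
    have hk' : k ≤ m := Nat.lt_succ_iff.1 (Finset.mem_range.1 hk)
    refine (((HasVal.one_sub_pow ζ _).mul ((HasVal.var ζ).pow _)).mul
      ((hasVal_sqProd hζ hk').pow 3)).mul (HasVal.pow ?_ 2)
    simpa using (hasVal_koebeSum hζ hk').add (hX.mul (hE k hk').1)
  · have h0 := sum_deform q_ne_zero (fun _ => q_pow_ne_one)
      (admissible_zero (fun _ => q_pow_ne_one)) m
    have h1 := sum_deform q_ne_zero (fun _ => q_pow_ne_one)
      (admissible_termParam q_ne_zero (fun _ => q_pow_ne_one) m) m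
    simp only [deform_zero, one_mul, mul_one] at h0
    -- Termwise 1 = 2D - D^2 + (1-D)^2, where 1 - D is X times a regular function.
    have h2 : ∑ k ∈ Finset.range (m + 1), (1 - q ^ (6 * k + 1)) * q ^ (3 * k) * sqProd q k ^ 3 =
        2 * (∑ k ∈ Finset.range (m + 1), (1 - q ^ (6 * k + 1)) * q ^ (3 * k) * sqProd q k ^ 3 *
          deform q (termParam q m) 1 k) -
        (∑ k ∈ Finset.range (m + 1), (1 - q ^ (6 * k + 1)) * q ^ (3 * k) * sqProd q k ^ 3 *
          (deform q (termParam q m) 1 k * deform q (termParam q m) 1 k)) +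
        termParam q m ^ 2 * ∑ k ∈ Finset.range (m + 1), (1 - q ^ (6 * k + 1)) * q ^ (3 * k) *
          sqProd q k ^ 3 * (koebeSum q k + termParam q m * E k) ^ 2 := by
      rw [Finset.mul_sum, Finset.mul_sum, ← Finset.sum_sub_distrib, ← Finset.sum_add_distrib]
      refine Finset.sum_congr rfl fun k hk => ?_
      rw [(hE k (Nat.lt_succ_iff.1 (Finset.mem_range.1 hk))).2]
      ring
    rw [h2, h0, h1, ratProd]
    ring

end Local

/-! ### Both sides compared, and the modulus assembled -/

section Main

variable {ζ : ℂ} {m : ℕ}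

/-- The harmonic-type sum on the right-hand side, without `q`-integers. -/
noncomputable def harmonicSum (m : ℕ) : RatFunc ℚ :=
  ∑ i ∈ Finset.range m, (koebe (q ^ (3 * i + 2)) - koebe (q ^ (3 * i + 3)))

theorem one_sub_q_ne_zero : 1 - q ≠ 0 := by simpa using one_sub_q_pow_ne_zero one_pos

theorem pow_div_qInt_sq (r : ℕ) : q ^ r / qInt r ^ 2 = (1 - q) ^ 2 * koebe (q ^ r) := by
  rw [qInt, koebe, div_pow, div_div_eq_mul_div]
  ring

theorem sum_pow_div_qInt_sq (m : ℕ) :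
    ∑ j ∈ Finset.Icc 1 m, (q ^ (3 * j - 1) / qInt (3 * j - 1) ^ 2 - q ^ (3 * j) / qInt (3 * j) ^ 2) =
      (1 - q) ^ 2 * harmonicSum m := by
  induction m with
  | zero => simp [harmonicSum]
  | succ m ih =>
    rw [Finset.sum_Icc_succ_top (by omega), ih, pow_div_qInt_sq, pow_div_qInt_sq, harmonicSum,
      harmonicSum, Finset.sum_range_succ, show 3 * (m + 1) - 1 = 3 * m + 2 by omega,
      show 3 * (m + 1) = 3 * m + 3 by ring]
    ring

/-- The right-hand side of the congruence. -/
noncomputable def closedForm (m : ℕ) : RatFunc ℚ :=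
  qInt (3 * m + 1) * ratProd 2 m ^ 3 *
    (1 + (1 - q ^ (3 * m + 1)) ^ 2 * (2 - q ^ (3 * m + 1)) * harmonicSum m)

theorem one_sub_root_ne_zero {d : ℕ} (hd : 1 < d) (hζ : IsPrimitiveRoot ζ d) : 1 - ζ ≠ 0 := by
  simpa using one_sub_pow_ne_zero_of_not_dvd hζ (a := 1) (by simpa using hd.ne')

theorem hasVal_qInt {d : ℕ} (hd : 1 < d) (hζ : IsPrimitiveRoot ζ d) (r : ℕ) :
    HasVal ζ (qInt r) ((1 - ζ ^ r) / (1 - ζ)) :=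
  (HasVal.one_sub_pow ζ r).div ((HasVal.one ζ).sub (HasVal.var ζ)) (one_sub_root_ne_zero hd hζ)

theorem hasVal_mul_koebe {d n r : ℕ} (hd : 0 < d) (hζ : IsPrimitiveRoot ζ d) (hn : d ∣ n)
    (hr : 0 < r) : ∃ v, HasVal ζ ((1 - q ^ n) ^ 2 * koebe (q ^ r)) v := by
  by_cases h : d ∣ r
  · obtain ⟨v, hv⟩ := hasVal_div_of_dvd hd hζ hn h hr
    rw [koebe, mul_div_left_comm, ← div_pow]
    exact ⟨_, ((HasVal.var ζ).pow r).mul (hv.pow 2)⟩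
  · exact ⟨_, ((HasVal.one_sub_pow ζ n).pow 2).mul
      (hasVal_koebe (one_sub_pow_ne_zero_of_not_dvd hζ h))⟩

/-- The factor [n] vanishes at ζ; possible double poles of `harmonicSum` are absorbed by (1-q^n)^2.
-/
theorem hasVal_closedForm {d : ℕ} (hd : 1 < d) (hζ : IsPrimitiveRoot ζ d) (hdm : d ∣ 3 * m + 1) :
    HasVal ζ (closedForm m) 0 := by
  have h3 : d.Coprime 3 := Nat.Coprime.coprime_dvd_left hdm (by simp)
  have h1 := hasVal_qInt hd hζ (3 * m + 1)
  rw [(hζ.pow_eq_one_iff_dvd _).2 hdm, sub_self, zero_div] at h1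
  obtain ⟨v, hv⟩ := hasVal_ratProd (by omega) hζ h3 2 m
  have hk : ∀ r, ∃ v, HasVal ζ ((1 - q ^ (3 * m + 1)) ^ 2 * koebe (q ^ (r + 1))) v := fun r =>
    hasVal_mul_koebe (by omega) hζ hdm (Nat.succ_pos r)
  choose κ hκ using hk
  have hsum := HasVal.sum (s := Finset.range m) fun i _ =>
    (hκ (3 * i + 1)).sub (hκ (3 * i + 2))
  simp only [← mul_sub] at hsum
  rw [← Finset.mul_sum] at hsum
  have h := (h1.mul (hv.pow 3)).mul ((HasVal.one ζ).add
    ((((HasVal.one ζ).add (HasVal.one ζ)).sub ((HasVal.var ζ).pow (3 * m + 1))).mul hsum))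
  rw [zero_mul, zero_mul] at h
  convert h using 1
  rw [closedForm, harmonicSum]
  ring

theorem exists_short_sum_sub_closedForm (hm : 0 < m) (hζ : IsPrimitiveRoot ζ (3 * m + 1)) :
    ∃ C, HasVal ζ C 0 ∧
      ∑ k ∈ Finset.range (m + 1), wpTerm k - closedForm m = (1 - q ^ (3 * m + 1)) ^ 4 * C := by
  obtain ⟨Ω, hΩ, hsum⟩ := exists_sum_eq hζ
  obtain ⟨E, e, hE, hexp⟩ := deform_expand hζ two_pos (by norm_num) (le_refl m)
  have hΛ : HasVal ζ (harmonicSum m) _ := HasVal.sum fun i hi =>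
    (hasVal_koebe (one_sub_root_pow_ne_zero hζ (a := 3 * i + 2) (by omega)
      (by have := Finset.mem_range.1 hi; omega))).sub
    (hasVal_koebe (one_sub_root_pow_ne_zero hζ (a := 3 * i + 3) (by omega)
      (by have := Finset.mem_range.1 hi; omega)))
  obtain ⟨v, hv⟩ := hasVal_ratProd (by omega) hζ (by simp) 2 m
  have hN : HasVal ζ (1 - q ^ (3 * m + 1)) 0 := by
    simpa [hζ.pow_eq_one] using HasVal.one_sub_pow ζ (3 * m + 1)
  have hQ : HasVal ζ (q ^ (3 * m + 1))⁻¹ 1 := by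
    have := (HasVal.var ζ).pow (3 * m + 1)
    rw [hζ.pow_eq_one] at this
    simpa using this.inv one_ne_zero
  -- With Q = q^n, the deformation supplies the coefficient 1/Q where the closed form has 2-Q; since
  -- 1/Q - (2-Q) = (1-Q)^2/Q, the discrepancy is of fourth order and still multiplied by 1-Q.
  have hC := (((hN.mul (hv.pow 3)).mul (hQ.mul (hΛ.sub (hQ.mul hE)))).add
    ((hQ.pow 2).mul hΩ)).div ((HasVal.one ζ).sub (HasVal.var ζ))
    (one_sub_root_ne_zero (by omega) hζ)
  refine ⟨_, by simpa using hC, ?_⟩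
  have hS : ∑ k ∈ Finset.range (m + 1), wpTerm k =
      (∑ k ∈ Finset.range (m + 1), (1 - q ^ (6 * k + 1)) * q ^ (3 * k) * sqProd q k ^ 3) /
        (1 - q) := by
    rw [Finset.sum_div]
    refine Finset.sum_congr rfl fun k _ => ?_
    rw [wpTerm, qInt, sqProd, ratProd, Finset.prod_pow]
    ring
  have hexp' : deform q (termParam q m) 2 m = 1 + termParam q m * harmonicSum m +
    termParam q m ^ 2 * E := hexp
  rw [hS, hsum, hexp', closedForm, qInt, termParam]
  have h1 := one_sub_q_ne_zero
  have h2 : q ^ (3 * m + 1) ≠ 0 := pow_ne_zero _ q_ne_zero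
  generalize q ^ (3 * m + 1) = Q at *
  generalize 1 - q = t at *
  field_simp
  ring

/-- For k > m the numerator contains 1-q^n to the sixth power, while no denominator vanishes at ζ as
k < n. -/
theorem exists_wpTerm_eq (hm : 0 < m) (hζ : IsPrimitiveRoot ζ (3 * m + 1)) {k : ℕ} (hk : m < k)
    (hk' : k ≤ 3 * m) : ∃ C, HasVal ζ C 0 ∧ wpTerm k = (1 - q ^ (3 * m + 1)) ^ 4 * C := by
  have hN : HasVal ζ (1 - q ^ (3 * m + 1)) 0 := by
    simpa [hζ.pow_eq_one] using HasVal.one_sub_pow ζ (3 * m + 1)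
  have hR := (HasVal.prod (s := (Finset.range k).erase m)
    fun i _ => HasVal.one_sub_pow ζ (3 * i + 1)).div
    (HasVal.prod (s := Finset.range k) fun i _ => HasVal.one_sub_pow ζ (3 * i + 3))
    (Finset.prod_ne_zero_iff.2 fun i hi => one_sub_pow_ne_zero_of_not_dvd hζ (by
      have := Finset.mem_range.1 hi
      simpa using not_dvd_three_mul (d := 3 * m + 1) (by simp) (l := 0) (i := i) (by omega)))
  have hC := (((hasVal_qInt (by omega) hζ (6 * k + 1)).mul (hR.pow 6)).mul
    ((HasVal.var ζ).pow (3 * k))).mul (hN.pow 2)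
  refine ⟨_, by simpa using hC, ?_⟩
  rw [wpTerm, ratProd, Finset.prod_div_distrib,
    ← Finset.mul_prod_erase _ _ (Finset.mem_range.2 hk)]
  ring

theorem exists_sum_sub_closedForm (hm : 0 < m) (hζ : IsPrimitiveRoot ζ (3 * m + 1)) {M : ℕ}
    (hM : M = m ∨ M = 3 * m) :
    ∃ C, HasVal ζ C 0 ∧
      ∑ k ∈ Finset.range (M + 1), wpTerm k - closedForm m = (1 - q ^ (3 * m + 1)) ^ 4 * C := by
  have key : ∀ j, m + j ≤ 3 * m → ∃ C, HasVal ζ C 0 ∧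
      ∑ k ∈ Finset.range (m + j + 1), wpTerm k - closedForm m =
        (1 - q ^ (3 * m + 1)) ^ 4 * C := by
    intro j
    induction j with
    | zero => exact fun _ => exists_short_sum_sub_closedForm hm hζ
    | succ j ih =>
      intro hj
      obtain ⟨C, hC, h⟩ := ih (by omega)
      obtain ⟨C', hC', h'⟩ := exists_wpTerm_eq hm hζ (k := m + (j + 1)) (by omega) hj
      refine ⟨C + C', by simpa using hC.add hC', ?_⟩
      rw [Finset.sum_range_succ, h', mul_add, ← h, ← add_assoc m j 1]
      ring
  obtain ⟨j, rfl⟩ : ∃ j, M = m + j := ⟨M - m, by omega⟩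
  exact key j (by omega)

theorem modulus_dvd_num (hm : 0 < m) {M : ℕ} (hM : M = m ∨ M = 3 * m) :
    qIntPoly (3 * m + 1) * cyclotomic (3 * m + 1) ℚ ^ 4 ∣
      (∑ k ∈ Finset.range (M + 1), wpTerm k - closedForm m).num := by
  obtain ⟨n, hn⟩ : ∃ n, n = 3 * m + 1 := ⟨_, rfl⟩
  rw [← hn]
  have hmem : n ∈ n.divisors.erase 1 := by
    simp only [Finset.mem_erase, Nat.mem_divisors]
    exact ⟨by omega, dvd_rfl, by omega⟩
  -- [n] is the product of Φ_d over the divisors d > 1 of n, so Φ_n occurs to the power 1 + 4 and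
  -- the others once.
  have hfac : qIntPoly n * cyclotomic n ℚ ^ 4 =
      ∏ d ∈ n.divisors.erase 1, cyclotomic d ℚ ^ (if d = n then 5 else 1) := by
    rw [qIntPoly, ← prod_cyclotomic_eq_geom_sum (by omega) ℚ, ← Finset.mul_prod_erase _ _ hmem,
      ← Finset.mul_prod_erase _ (fun d => cyclotomic d ℚ ^ (if d = n then 5 else 1)) hmem,
      if_pos rfl]
    have h : ∏ d ∈ (n.divisors.erase 1).erase n, cyclotomic d ℚ ^ (if d = n then 5 else 1) =
        ∏ d ∈ (n.divisors.erase 1).erase n, cyclotomic d ℚ :=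
      Finset.prod_congr rfl fun d hd => by rw [if_neg (Finset.ne_of_mem_erase hd), pow_one]
    rw [h]
    ring
  rw [hfac]
  refine Finset.prod_dvd_of_coprime (fun a _ b _ hab => ?_) fun d hd => ?_
  · exact (cyclotomic.isCoprime_rat hab).pow
  · obtain ⟨hd1, hdn⟩ := Finset.mem_erase.1 hd
    have hdvd := Nat.dvd_of_mem_divisors hdn
    have hd0 : 0 < d := Nat.pos_of_mem_divisors hdn
    obtain ⟨ζ, hζ⟩ : ∃ ζ : ℂ, IsPrimitiveRoot ζ d :=
      ⟨_, Complex.isPrimitiveRoot_exp d hd0.ne'⟩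
    split_ifs with h
    · rw [h] at hζ hd0 ⊢
      obtain ⟨C, hC, hEq⟩ := exists_sum_sub_closedForm hm (hn ▸ hζ) hM
      have hf : cyclotomic n ℚ ^ 4 ∣ (1 - X ^ n) ^ 4 := by
        refine pow_dvd_pow_of_dvd ?_ 4
        rw [← neg_sub, dvd_neg]
        exact cyclotomic.dvd_X_pow_sub_one n ℚ
      have hdiv := pow_succ_dvd_num hd0 hζ hf hC
      rw [hEq, ← hn]
      simpa [q, RatFunc.algebraMap_X] using hdiv
    · have hd1' : 1 < d := by omega
      have hC := (hasVal_sum hd1' hζ (hn ▸ hdvd) hM).sub (hasVal_closedForm hd1' hζ (hn ▸ hdvd))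
      rw [sub_zero] at hC
      simpa using pow_succ_dvd_num hd0 hζ (k := 0) (f := 1) (by simp) hC

end Main
end QSuper

open QSuper in
theorem theorem1p2 (n : ℕ) (hn : 0 < n) (hn3 : n ≡ 1 [MOD 3])
    (M : ℕ) (hM : M = (n - 1) / 3 ∨ M = n - 1) :
    RatCongr (qIntPoly n * Polynomial.cyclotomic n ℚ ^ 4)
      (∑ k ∈ Finset.range (M + 1),
        qInt (6 * k + 1) * (qPoch q (q ^ 3) k ^ 6 / qPoch (q ^ 3) (q ^ 3) k ^ 6) * q ^ (3 * k))
      (qInt n *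
        (qPoch (q ^ 2) (q ^ 3) ((n - 1) / 3) ^ 3 / qPoch (q ^ 3) (q ^ 3) ((n - 1) / 3) ^ 3) *
        (1 + qInt n ^ 2 * (2 - q ^ n) *
          ∑ j ∈ Finset.Icc 1 ((n - 1) / 3),
            (q ^ (3 * j - 1) / qInt (3 * j - 1) ^ 2 - q ^ (3 * j) / qInt (3 * j) ^ 2))) := by
  obtain ⟨m, rfl⟩ : ∃ m, n = 3 * m + 1 := ⟨n / 3, by rw [Nat.ModEq] at hn3; omega⟩
  have hm : (3 * m + 1 - 1) / 3 = m := by omega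
  rw [hm] at hM ⊢
  rw [Nat.add_sub_cancel] at hM
  have hL : ∀ k, qInt (6 * k + 1) * (qPoch q (q ^ 3) k ^ 6 / qPoch (q ^ 3) (q ^ 3) k ^ 6) *
      q ^ (3 * k) = wpTerm k := by
    intro k
    rw [wpTerm, ← qPoch_div_qPoch, div_pow, pow_one]
  have hR : qInt (3 * m + 1) *
        (qPoch (q ^ 2) (q ^ 3) m ^ 3 / qPoch (q ^ 3) (q ^ 3) m ^ 3) *
        (1 + qInt (3 * m + 1) ^ 2 * (2 - q ^ (3 * m + 1)) *
          ∑ j ∈ Finset.Icc 1 m,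
            (q ^ (3 * j - 1) / qInt (3 * j - 1) ^ 2 - q ^ (3 * j) / qInt (3 * j) ^ 2)) =
      closedForm m := by
    have h : (qInt (3 * m + 1) * (1 - q)) ^ 2 = (1 - q ^ (3 * m + 1)) ^ 2 := by
      rw [qInt, div_mul_cancel₀ _ one_sub_q_ne_zero]
    rw [sum_pow_div_qInt_sq, ← div_pow, qPoch_div_qPoch, closedForm, ← h]
    ring
  simp only [hL]
  rw [hR, RatCongr]
  -- For n = 1 both sides equal 1; this case is separate because Φ_1 does not divide [1].
  rcases Nat.eq_zero_or_pos m with rfl | hpos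
  · obtain rfl : M = 0 := by omega
    have h1 : qInt 1 = 1 := by rw [qInt, pow_one, div_self one_sub_q_ne_zero]
    simp [wpTerm, closedForm, harmonicSum, ratProd, h1]
  · exact modulus_dvd_num hpos hM
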